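/- Fix $T\in\mathbb N$ and let $\mathcal T=\{1,\dots,T\}$. On a probability space let, for $i\in\mathcal T$, $k\ge 1$ and $\alpha\ge 0$, $D_{i,k}$ be random variables with values in $\mathcal T$ (almost surely), $Z_{i,k}$ real random variables and $M_i^\alpha$ random variables with values in $\{0,1,2,\dots\}$, such that: (GM1) for each $i\in\mathcal T$ the pairs $(D_{i,k},Z_{i,k})$, $k\ge1$, are i.i.d., with a common distribution that does not depend on $i$; a generic pair $(D,Z)$ with this distribution satisfies $\operatorname{E}[Z^2]<\infty$ and $\operatorname{E}[Z\,I\{D=t\}]>0$ for each $t\in\mathcal T$; (GM2) for each $i\in\mathcal T$ and each $\alpha$, the sequence $(D_{i,k},Z_{i,k})_{k\ge1}$ and $M_i^\alpha$ are independent; (GM3) for each $\alpha$, the families $\{M_i^\alpha,(D_{i,k},Z_{i,k})_{k\ge1}\}$, $i\in\mathcal T$, are independent; (GM4) for each $i\in\mathcal T$ there is $\lambda_i\in(0,\infty)$ with $M_i^\alpha/\alpha\to\lambda_i$ a.s. as $\alpha\to\infty$. Put $$C^\alpha_{i,t}=\sum_{k=1}^{M_i^\alpha}Z_{i,k}I\{D_{i,k}\le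 t\},\qquad \widehat f_t=\frac{\sum_{i=1}^{T-t}C^\alpha_{i,t+1}}{\sum_{i=1}^{T-t}C^\alpha_{i,t}},\qquad \widehat\sigma_t^2=\frac1{T-t-1}\sum_{i=1}^{T-t}C^\alpha_{i,t}\Big(\frac{C^\alpha_{i,t+1}}{C^\alpha_{i,t}}-\widehat f_t\Big)^2,$$ where a quotient with denominator $0$ is read as $0$. Then, as $\alpha\to\infty$: 1. For each $t\in\mathcal T$ with $t\le T-1$, $$\widehat f_t\to f_t:=\frac{\operatorname{E}[Z\,I\{D\le t+1\}]}{\operatorname{E}[Z\,I\{D\le t\}]}\quad\text{a.s.}$$ 2. For each $i\in\mathcal T$ with $i\ge2$, $$\frac{C^\alpha_{i,T-i+1}\prod_{t=T-i+1}^{T-1}\widehat f_t}{C^\alpha_{i,T}}\to1\quad\text{a.s.}$$ 3. For each $t\in\mathcal T$ with $t\le T-2$, $\widehat\sigma_t^2$ converges in distribution to $\sigma_t^2\,\chi^2_{T-t-1}/(T-t-1)$, where $\chi^2_\nu$ has the chi-squared distribution with $\nu$ degrees of freedom and $$\sigma_t^2=(f_t-1)\bigg(\frac{\operatorname{E}[Z^2I\{D=t+1\}]}{\operatorname{E}[Z\,I\{D=t+1\}]}+(f_t-1)\frac{\operatorname{E}[Z^2I\{D\le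 t\}]}{\operatorname{E}[Z\,I\{D\le t\}]}\bigg).$$ Moreover $\sigma_t^2>0$, and this limit law is non-degenerate (not a point mass). -/

import Mathlib

open MeasureTheory ProbabilityTheory Filter Topology
open scoped NNReal

noncomputable section

namespace ChainLadder

/-- `E[Z ^ p * I{D ∈ S}]` for a generic pair `(D, Z)` (development year, claim size)
with law `ν` on `ℕ × ℝ`. -/
def claimMoment (ν : Measure (ℕ × ℝ)) (p : ℕ) (S : Set ℕ) : ℝ :=
  ∫ x, x.2 ^ p * S.indicator 1 x.1 ∂ν

/-- The general model with `T` accident years and `T` development years, both numbered `1, …, T`.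
For exposure `α ≥ 0` and accident year `i`, `M α i` is the number of accident events, and
`D i k`, `Z i k` are the development year and the size of the `k`-th claim (`k = 0, 1, 2, …`).
The measure `ν` is the law of the generic pair `(D, Z)`. Quantities whose accident year lies
outside `{1, …, T}` are never used. -/
structure IsGeneralModel {Ω : Type*} [MeasurableSpace Ω] (P : Measure Ω) (T : ℕ)
    (M : ℝ≥0 → ℕ → Ω → ℕ) (D : ℕ → ℕ → Ω → ℕ) (Z : ℕ → ℕ → Ω → ℝ)
    (ν : Measure (ℕ × ℝ)) : Prop where
  measurable_M : ∀ α, ∀ i ∈ Finset.Icc 1 T, Measurable (M α i)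
  measurable_D : ∀ i ∈ Finset.Icc 1 T, ∀ k, Measurable (D i k)
  measurable_Z : ∀ i ∈ Finset.Icc 1 T, ∀ k, Measurable (Z i k)
  /-- Development years take values in `{1, …, T}`. -/
  dev_mem : ∀ᵐ x ∂ν, x.1 ∈ Finset.Icc 1 T
  /-- (GM1) Within each accident year the pairs `(D i k, Z i k)`, `k = 0, 1, …`, are independent. -/
  claims_indep : ∀ i ∈ Finset.Icc 1 T, iIndepFun (fun k ω => (D i k ω, Z i k ω)) P
  /-- (GM1) All the pairs have the same law `ν`, in every accident year. -/
  claims_law : ∀ i ∈ Finset.Icc 1 T, ∀ k, HasLaw (fun ω => (D i k ω, Z i k ω)) ν P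
  /-- (GM1) `E[Z ^ 2] < ∞`. -/
  sq_integrable : Integrable (fun x : ℕ × ℝ => x.2 ^ 2) ν
  /-- (GM1) `E[Z I{D = t}] > 0` for each development year `t`. -/
  mean_pos : ∀ t ∈ Finset.Icc 1 T, 0 < claimMoment ν 1 {t}
  /-- (GM2) -/
  claims_indep_count : ∀ α, ∀ i ∈ Finset.Icc 1 T,
    IndepFun (fun ω (k : ℕ) => (D i k ω, Z i k ω)) (M α i) P
  /-- (GM3) -/
  years_indep : ∀ α, iIndepFun
    (fun (i : Finset.Icc 1 T) ω => (M α i ω, fun k : ℕ => (D i k ω, Z i k ω))) P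
  /-- (GM4) -/
  exposure : ∀ i ∈ Finset.Icc 1 T, ∃ l : ℝ, 0 < l ∧
    ∀ᵐ ω ∂P, Tendsto (fun α : ℝ≥0 => (M α i ω : ℝ) / (α : ℝ)) atTop (𝓝 l)

section Estimators

variable {Ω : Type*} (T : ℕ) (M : ℝ≥0 → ℕ → Ω → ℕ) (D : ℕ → ℕ → Ω → ℕ) (Z : ℕ → ℕ → Ω → ℝ)

/-- The accumulated total claims amount `C i t` at exposure `α`: the sum of the sizes of the first
`M α i` claims of accident year `i` whose development year is at most `t`. -/
def cumClaims (α : ℝ≥0) (i t : ℕ) (ω : Ω) : ℝ :=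
  ∑ k ∈ Finset.range (M α i ω), if D i k ω ≤ t then Z i k ω else 0

/-- The chain-ladder development factor estimator. -/
def fHat (α : ℝ≥0) (t : ℕ) (ω : Ω) : ℝ :=
  (∑ i ∈ Finset.Icc 1 (T - t), cumClaims M D Z α i (t + 1) ω) /
    ∑ i ∈ Finset.Icc 1 (T - t), cumClaims M D Z α i t ω

/-- The chain-ladder predictor of the ultimate claims amount of accident year `i`. -/
def predictor (α : ℝ≥0) (i : ℕ) (ω : Ω) : ℝ :=
  cumClaims M D Z α i (T - i + 1) ω *
    ∏ t ∈ Finset.Icc (T - i + 1) (T - 1), fHat T M D Z α t ω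

/-- Mack's variance estimator. -/
def sigmaSqHat (α : ℝ≥0) (t : ℕ) (ω : Ω) : ℝ :=
  1 / ((T - t - 1 : ℕ) : ℝ) *
    ∑ i ∈ Finset.Icc 1 (T - t), cumClaims M D Z α i t ω *
      (cumClaims M D Z α i (t + 1) ω / cumClaims M D Z α i t ω - fHat T M D Z α t ω) ^ 2

end Estimators

/-- `f t = E[Z I{D ≤ t + 1}] / E[Z I{D ≤ t}]`. -/
def devFactor (ν : Measure (ℕ × ℝ)) (t : ℕ) : ℝ :=
  claimMoment ν 1 (Set.Iic (t + 1)) / claimMoment ν 1 (Set.Iic t)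

/-- The constant `σ² t` in the limit of Mack's variance estimator. -/
def sigmaSq (ν : Measure (ℕ × ℝ)) (t : ℕ) : ℝ :=
  (devFactor ν t - 1) *
    (claimMoment ν 2 {t + 1} / claimMoment ν 1 {t + 1} +
      (devFactor ν t - 1) * (claimMoment ν 2 (Set.Iic t) / claimMoment ν 1 (Set.Iic t)))

/-- The chi-squared distribution with `n` degrees of freedom: the law of the sum of the squares of
`n` independent standard normal variables. -/
def chiSqLaw (n : ℕ) : Measure ℝ :=
  (Measure.pi fun _ : Fin n => gaussianReal 0 1).map fun x => ∑ j, x j ^ 2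

instance chiSqLaw_isProbabilityMeasure (n : ℕ) : IsProbabilityMeasure (chiSqLaw n) :=
  Measure.isProbabilityMeasure_map
    (Measurable.aemeasurable (Finset.measurable_sum _ fun j _ => (measurable_pi_apply j).pow_const 2))

end ChainLadder

end

/-! Each $C^\alpha_{i,t}$ is a sum of i.i.d. terms with a random number of summands. The strong law
read along $M_i^\alpha\to\infty$, multiplied by $M_i^\alpha/\alpha\to\lambda_i$, gives
$C^\alpha_{i,t}/\alpha\to\lambda_i E[Z I\{D\le t\}]$ a.s. (`tendsto_cumClaims_div`). The two
consistency claims follow by taking quotients: the rates $\lambda_i$ cancel, and the product of the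
$f_t$ telescopes.

For the variance estimator put $R_i=C_{i,t+1}-f_tC_{i,t}$. A weighted-variance identity
(`sum_mul_sq_div_sub_eq`) turns $(T-t-1)\widehat\sigma_t^2$ into $\sum_i R_i^2/C_{i,t}-(\sum_i
R_i)^2/\sum_i C_{i,t}$. Each $R_i$ is a random sum of centred i.i.d. residuals of variance
$v=\sigma_t^2E[Z I\{D\le t\}]$. Since counts are independent of claims and years are independent of
each other, the $R_i/\sqrt{vM_i}$ converge jointly to independent standard normals $N_i$
(`tendstoInDistribution_normalizedSum_pi`). The remaining coefficients converge a.s., so Slutsky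
gives the limit $\frac{\sigma_t^2}{T-t-1}\big(\sum_i N_i^2-(\sum_i u_iN_i)^2\big)$ with
$u_i=\sqrt{\lambda_i/\sum_j\lambda_j}$. As $u$ is a unit vector, Cochran's theorem
(`map_sum_sq_sub_sq_pi_gaussianReal`) identifies the bracket as $\chi^2_{T-t-1}$. -/

namespace ChainLadder

/-! ### Convergence in distribution: random indices, independent components, Slutsky. -/

section General

/-- Almost sure convergence along a countably generated filter implies convergence in measure. -/
lemma tendstoInMeasure_of_tendsto_ae_filter {Ω ι E : Type*} [MeasurableSpace Ω] {P : Measure Ω}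
    [IsFiniteMeasure P] [PseudoEMetricSpace E] {l : Filter ι} [l.IsCountablyGenerated]
    {f : ι → Ω → E} {g : Ω → E} (hf : ∀ a, AEStronglyMeasurable (f a) P)
    (h : ∀ᵐ ω ∂P, Tendsto (fun a => f a ω) l (𝓝 (g ω))) : TendstoInMeasure P f l g := by
  intro ε hε
  refine tendsto_of_seq_tendsto fun u hu => ?_
  refine tendstoInMeasure_of_tendsto_ae (f := fun n => f (u n)) (g := g) (fun n => hf _) ?_ ε hε
  filter_upwards [h] with ω hω using hω.comp hu

/-- If `S n` converges in distribution as `n → ∞`, then so does `S (N a)` for random indices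
`N a → ∞` that are independent of the sequence `S`. -/
lemma tendstoInDistribution_random_index {Ω Ω' ι E : Type*} [MeasurableSpace Ω]
    [MeasurableSpace Ω'] {P : Measure Ω} [IsProbabilityMeasure P] {P' : Measure Ω'}
    [IsProbabilityMeasure P'] {l : Filter ι} [l.IsCountablyGenerated]
    [TopologicalSpace E] [MeasurableSpace E] [OpensMeasurableSpace E]
    {S : ℕ → Ω → E} {Y : Ω' → E} {N : ι → Ω → ℕ}
    (hS : ∀ n, Measurable (S n)) (hN : ∀ a, Measurable (N a))
    (hindep : ∀ a, IndepFun (fun ω n => S n ω) (N a) P)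
    (hlim : ∀ᵐ ω ∂P, Tendsto (fun a => N a ω) l atTop)
    (h : TendstoInDistribution S atTop Y (fun _ => P) P') :
    TendstoInDistribution (fun a ω => S (N a ω) ω) l Y (fun _ => P) P' := by
  have hpair : Measurable fun p : (ℕ → E) × ℕ => p.1 p.2 :=
    measurable_from_prod_countable_left fun n => measurable_pi_apply n
  have hSpi : Measurable fun ω n => S n ω := measurable_pi_lambda _ hS
  have hSN : ∀ a, Measurable fun ω => S (N a ω) ω := fun a => hpair.comp (hSpi.prodMk (hN a))
  refine ⟨fun a => (hSN a).aemeasurable, h.aemeasurable_limit, ?_⟩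
  refine ProbabilityMeasure.tendsto_iff_forall_integral_tendsto.2 fun f => ?_
  have ht := ProbabilityMeasure.tendsto_iff_forall_integral_tendsto.1 h.tendsto f
  simp only [ProbabilityMeasure.coe_mk] at ht ⊢
  have hfm : Measurable f := f.continuous.measurable
  -- By independence and Fubini, the law of `S (N a)` is the mixture of the laws of the `S n` with
  -- weights the law of `N a`. Since `N a → ∞` a.s., the inner integrals converge a.s. and dominated
  -- convergence concludes.
  have key : ∀ a, ∫ x, f x ∂(P.map fun ω => S (N a ω) ω)
      = ∫ ω, (∫ x, f x ∂(P.map (S (N a ω)))) ∂P := by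
    intro a
    have : IsProbabilityMeasure (P.map (N a)) := Measure.isProbabilityMeasure_map (hN a).aemeasurable
    have : IsProbabilityMeasure (P.map fun ω n => S n ω) :=
      Measure.isProbabilityMeasure_map hSpi.aemeasurable
    have hmap : (P.map fun ω => S (N a ω) ω)
        = ((P.map fun ω n => S n ω).prod (P.map (N a))).map fun p => p.1 p.2 := by
      rw [← (indepFun_iff_map_prod_eq_prod_map_map hSpi.aemeasurable (hN a).aemeasurable).1
        (hindep a), Measure.map_map hpair (hSpi.prodMk (hN a))]
      rfl
    rw [hmap, integral_map hpair.aemeasurable hfm.aestronglyMeasurable,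
      integral_prod_symm (fun p : (ℕ → E) × ℕ => f (p.1 p.2))
        (Integrable.of_bound (hfm.comp hpair).aestronglyMeasurable ‖f‖
        (ae_of_all _ fun _ => f.norm_coe_le_norm _)),
      integral_map (hN a).aemeasurable (measurable_of_countable _).aestronglyMeasurable]
    refine integral_congr_ae (ae_of_all _ fun ω => ?_)
    simp only
    rw [integral_map (f := fun s : ℕ → E => f (s (N a ω))) hSpi.aemeasurable
        (hfm.comp (measurable_pi_apply _)).aestronglyMeasurable,
      integral_map (hS _).aemeasurable hfm.aestronglyMeasurable]
  simp_rw [key]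
  have hconst : (∫ x, f x ∂(P'.map Y)) = ∫ _ω, (∫ x, f x ∂(P'.map Y)) ∂P := by simp
  rw [hconst]
  refine tendsto_integral_filter_of_dominated_convergence (fun _ => ‖f‖) ?_ ?_
    (integrable_const _) ?_
  · exact Eventually.of_forall fun a =>
      ((measurable_of_countable fun n => ∫ x, f x ∂(P.map (S n))).comp
        (hN a)).aestronglyMeasurable
  · refine Eventually.of_forall fun a => ae_of_all _ fun ω => ?_
    have : IsProbabilityMeasure (P.map (S (N a ω))) :=
      Measure.isProbabilityMeasure_map (hS _).aemeasurable
    exact f.norm_integral_le_norm _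
  · filter_upwards [hlim] with ω hω using ht.comp hω

/-- Vectors with independent components converge in distribution if their components do. -/
lemma tendstoInDistribution_pi_of_iIndepFun {Ω ι κ E : Type*} [MeasurableSpace Ω]
    {P : Measure Ω} [IsProbabilityMeasure P] {l : Filter ι} [Fintype κ] [TopologicalSpace E]
    [SecondCountableTopology E] [TopologicalSpace.PseudoMetrizableSpace E] [MeasurableSpace E]
    [BorelSpace E] {μ : Measure E} [IsProbabilityMeasure μ] {X : ι → κ → Ω → E}
    (hindep : ∀ a, iIndepFun (X a) P)
    (h : ∀ i, TendstoInDistribution (fun a => X a i) l id (fun _ => P) μ) :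
    TendstoInDistribution (fun a ω i => X a i ω) l id (fun _ => P) (Measure.pi fun _ : κ => μ) where
  forall_aemeasurable a := aemeasurable_pi_lambda _ fun i => (h i).forall_aemeasurable a
  tendsto := by
    -- By independence the joint law is the product of the marginals, and finite products are weakly
    -- continuous in their factors.
    have ht := (ProbabilityMeasure.continuous_pi.tendsto _).comp
      (tendsto_pi_nhds.2 fun i => (h i).tendsto)
    refine (ht.congr fun a => ?_).mono_right (le_of_eq (congrArg 𝓝 (Subtype.ext ?_)))
    · exact Subtype.ext ((iIndepFun_iff_map_fun_eq_pi_map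
        fun i => (h i).forall_aemeasurable a).1 (hindep a)).symm
    · simp only [Measure.map_id]
      rfl

/-- In convergence in distribution only the law of the limit matters. -/
lemma tendstoInDistribution_congr_law {Ω Ω' Ω'' ι E : Type*} [MeasurableSpace Ω]
    [MeasurableSpace Ω'] [MeasurableSpace Ω''] {P : Measure Ω} [IsProbabilityMeasure P]
    {P' : Measure Ω'} [IsProbabilityMeasure P'] {P'' : Measure Ω''} [IsProbabilityMeasure P'']
    {l : Filter ι} [TopologicalSpace E] [MeasurableSpace E] [OpensMeasurableSpace E]
    {X : ι → Ω → E} {Y : Ω' → E} {Y' : Ω'' → E}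
    (h : TendstoInDistribution X l Y (fun _ => P) P') (hY' : AEMeasurable Y' P'')
    (hlaw : P'.map Y = P''.map Y') : TendstoInDistribution X l Y' (fun _ => P) P'' where
  forall_aemeasurable := h.forall_aemeasurable
  aemeasurable_limit := hY'
  tendsto := by
    exact h.tendsto.mono_right (le_of_eq (congrArg 𝓝 (Subtype.ext hlaw)))

/-- A form of Slutsky's theorem: a continuous function of a vector that converges in distribution
and of coefficients that converge almost surely to constants. -/
lemma tendstoInDistribution_of_eventually_eq_continuous {Ω Ω' ι E E' F : Type*}
    [MeasurableSpace Ω] [MeasurableSpace Ω'] {P : Measure Ω} [IsProbabilityMeasure P]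
    {P' : Measure Ω'} [IsProbabilityMeasure P'] {l : Filter ι} [l.IsCountablyGenerated]
    [SeminormedAddCommGroup E] [SecondCountableTopology E] [MeasurableSpace E] [BorelSpace E]
    [SeminormedAddCommGroup E'] [SecondCountableTopology E'] [MeasurableSpace E'] [BorelSpace E']
    [SeminormedAddCommGroup F] [SecondCountableTopology F] [MeasurableSpace F] [BorelSpace F]
    {X : ι → Ω → E} {Y : Ω' → E} {A : ι → Ω → E'} {c : E'} {g : E × E' → F} {S : ι → Ω → F}
    (hX : TendstoInDistribution X l Y (fun _ => P) P') (hAm : ∀ a, Measurable (A a))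
    (hA : ∀ᵐ ω ∂P, Tendsto (fun a => A a ω) l (𝓝 c)) (hg : Continuous g)
    (hS : ∀ a, Measurable (S a)) (heq : ∀ᵐ ω ∂P, ∀ᶠ a in l, S a ω = g (X a ω, A a ω)) :
    TendstoInDistribution S l (fun ω => g (Y ω, c)) (fun _ => P) P' := by
  have hQ := hX.continuous_comp_prodMk_of_tendstoInMeasure_const hg
    (tendstoInMeasure_of_tendsto_ae_filter
      (fun a => (hAm a).stronglyMeasurable.aestronglyMeasurable) hA)
    fun a => (hAm a).aemeasurable
  -- Almost surely the difference is eventually zero, hence it tends to zero in measure.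
  refine tendstoInDistribution_of_tendstoInMeasure_sub _ _ hQ ?_ fun a => (hS a).aemeasurable
  refine tendstoInMeasure_of_tendsto_ae_filter (fun a =>
    ((hS a).aemeasurable.sub (hQ.forall_aemeasurable a)).aestronglyMeasurable) ?_
  filter_upwards [heq] with ω hω
  refine tendsto_const_nhds.congr' ?_
  filter_upwards [hω] with a ha
  simp [ha]

end General

/-! ### Gaussian quadratic forms and chi-squared laws. -/

section Gaussian

/-- Cochran's theorem for one linear constraint. -/
lemma map_sum_sq_sub_sq_pi_gaussianReal {κ : Type*} [Fintype κ] {m : ℕ}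
    (hcard : Fintype.card κ = m + 1) {u : κ → ℝ} (hu : ∑ i, u i ^ 2 = 1) :
    (Measure.pi fun _ : κ => gaussianReal 0 1).map
      (fun x => ∑ i, x i ^ 2 - (∑ i, u i * x i) ^ 2) = chiSqLaw m := by
  set E := EuclideanSpace ℝ κ
  set v : E := WithLp.toLp 2 u
  have hv : ‖v‖ = 1 := by
    have : ‖v‖ ^ 2 = 1 := by
      rw [EuclideanSpace.real_norm_sq_eq]; exact hu
    nlinarith [norm_nonneg v]
  -- Complete the unit vector `u` to an orthonormal basis. By Parseval the form is the sum of
  -- squares of the other `m` coordinates, and by rotation invariance these are independent standard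
  -- normals.
  obtain ⟨b, hb⟩ := Orthonormal.exists_orthonormalBasis_extension_of_card_eq (𝕜 := ℝ) (E := E)
    (ι := Fin (m + 1)) (by simp [E, hcard]) (v := fun _ => v) (s := {0}) (by
      rw [orthonormal_iff_ite]
      rintro ⟨i, rfl⟩ ⟨j, rfl⟩
      simp [hv])
  have hb0 : b 0 = v := hb 0 rfl
  have hfun : (fun x : κ → ℝ => ∑ i, x i ^ 2 - (∑ i, u i * x i) ^ 2)
      = (fun y : E => ∑ j : Fin m, (inner ℝ (b j.succ) y) ^ 2) ∘ WithLp.toLp 2 := by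
    funext x
    have h1 := b.sum_sq_inner_right (WithLp.toLp 2 x)
    rw [Fin.sum_univ_succ, hb0, EuclideanSpace.real_norm_sq_eq] at h1
    have h2 : inner ℝ v (WithLp.toLp 2 x : E) = ∑ i, u i * x i := by
      rw [PiLp.inner_apply]
      simp [v, mul_comm]
    rw [h2] at h1
    simp only [Function.comp_apply]
    have h3 : ∑ i, x i ^ 2 = ∑ i, (WithLp.toLp 2 x : E) i ^ 2 := rfl
    rw [h3, ← h1]; ring
  have hmeas : Measurable fun y : E => ∑ j : Fin m, (inner ℝ (b j.succ) y) ^ 2 := by fun_prop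
  rw [hfun, ← Measure.map_map hmeas (by fun_prop), map_pi_eq_stdGaussian,
    stdGaussian_eq_map_pi_orthonormalBasis b, Measure.map_map hmeas (by fun_prop)]
  have hpres := measurePreserving_snd.comp
    (measurePreserving_piFinSuccAbove (fun _ : Fin (m + 1) => gaussianReal 0 1) 0)
  rw [chiSqLaw, ← hpres.map_eq, Measure.map_map (by fun_prop) hpres.measurable]
  congr 1
  funext x
  simp only [Function.comp_apply, inner_sum, inner_smul_right, b.inner_eq_ite]
  simp [Fin.tail]

lemma isOpenPosMeasure_gaussianReal : (gaussianReal 0 1).IsOpenPosMeasure :=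
  (gaussianReal_absolutelyContinuous' 0 one_ne_zero).isOpenPosMeasure

/-- A rescaled chi-squared law is not a point mass. -/
lemma map_const_mul_div_chiSqLaw_ne_dirac {m : ℕ} (hm : 0 < m) {s r : ℝ} (hs : s ≠ 0)
    (hr : r ≠ 0) (c : ℝ) :
    (chiSqLaw m).map (fun x : ℝ => s * (x / r)) ≠ Measure.dirac c := by
  intro h
  have := isOpenPosMeasure_gaussianReal
  have hmeas : Measurable fun x : ℝ => s * (x / r) := by fun_prop
  have hmeas2 : Measurable fun x : Fin m → ℝ => ∑ j, x j ^ 2 := by fun_prop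
  have h0 : (Measure.pi fun _ : Fin m => gaussianReal 0 1)
      {x | s * ((∑ j, x j ^ 2) / r) ≠ c} = 0 := by
    have h1 := congrArg (fun μ => μ {c}ᶜ) h
    simp only [chiSqLaw] at h1
    rw [Measure.map_map hmeas hmeas2, Measure.map_apply (hmeas.comp hmeas2)
      (measurableSet_singleton c).compl] at h1
    rw [Measure.dirac_apply' _ (measurableSet_singleton c).compl] at h1
    exact h1.trans (by simp)
  -- The Gaussian measure charges every nonempty open set, so this null open set is empty and the
  -- form is constant; its values at `0` and at the all-ones vector differ.
  have hopen : IsOpen {x : Fin m → ℝ | s * ((∑ j, x j ^ 2) / r) ≠ c} :=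
    isOpen_ne_fun (by fun_prop) continuous_const
  rw [hopen.measure_eq_zero_iff (μ := Measure.pi fun _ : Fin m => gaussianReal 0 1), Set.eq_empty_iff_forall_notMem] at h0
  have ha := h0 0
  have hb := h0 fun _ => 1
  simp only [Set.mem_ofPred_eq, not_not, Pi.zero_apply] at ha hb
  rw [← ha] at hb
  have : (m : ℝ) ≠ 0 := by positivity
  simp [hs, hr, this] at hb

end Gaussian

/-! ### Moments of a single claim and of its residual. -/

section Moments

/-- The integrand of `claimMoment`. -/
noncomputable def claimTerm (p : ℕ) (S : Set ℕ) (x : ℕ × ℝ) : ℝ := x.2 ^ p * S.indicator 1 x.1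

lemma measurable_claimTerm (p : ℕ) (S : Set ℕ) : Measurable (claimTerm p S) :=
  (measurable_snd.pow_const p).mul ((measurable_of_countable (S.indicator 1)).comp measurable_fst)

lemma claimTerm_Iic_succ (p t : ℕ) (x : ℕ × ℝ) :
    claimTerm p (Set.Iic (t + 1)) x = claimTerm p (Set.Iic t) x + claimTerm p {t + 1} x := by
  simp only [claimTerm, Set.indicator_apply, Set.mem_Iic, Set.mem_singleton_iff, Pi.one_apply]
  rcases lt_trichotomy x.1 (t + 1) with h | h | h
  · simp [h.le, Nat.lt_succ_iff.1 h, h.ne]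
  · simp [h]
  · have h1 : ¬ x.1 ≤ t + 1 := by omega
    have h2 : ¬ x.1 ≤ t := by omega
    have h3 : ¬ x.1 = t + 1 := by omega
    simp [h1, h2, h3]

/-- The residual of a single claim: its contribution to `C i (t + 1) - f * C i t`. -/
noncomputable def claimResidual (f : ℝ) (t : ℕ) (x : ℕ × ℝ) : ℝ :=
  claimTerm 1 (Set.Iic (t + 1)) x - f * claimTerm 1 (Set.Iic t) x

lemma measurable_claimResidual (f : ℝ) (t : ℕ) : Measurable (claimResidual f t) :=
  (measurable_claimTerm _ _).sub ((measurable_claimTerm _ _).const_mul f)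

/-- The residual is $Z I\{D=t+1\}-(f-1)Z I\{D\le t\}$; the two events are disjoint, so the cross
term vanishes. -/
lemma claimResidual_sq (f : ℝ) (t : ℕ) (x : ℕ × ℝ) :
    claimResidual f t x ^ 2 =
      claimTerm 2 {t + 1} x + (f - 1) ^ 2 * claimTerm 2 (Set.Iic t) x := by
  rw [claimResidual, claimTerm_Iic_succ]
  simp only [claimTerm, Set.indicator_apply, Set.mem_Iic, Set.mem_singleton_iff, Pi.one_apply]
  by_cases h1 : x.1 ≤ t
  · have h2 : ¬ x.1 = t + 1 := by omega
    simp only [h1, h2, if_true, if_false]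
    ring
  · simp only [h1, if_false]
    split_ifs <;> ring

variable {ν : Measure (ℕ × ℝ)}

lemma integrable_claimTerm {p : ℕ} (hp : Integrable (fun x : ℕ × ℝ => x.2 ^ p) ν) (S : Set ℕ) :
    Integrable (claimTerm p S) ν := by
  refine (hp.indicator (measurable_fst (Set.to_countable S).measurableSet)).congr
    (ae_of_all _ fun x => ?_)
  by_cases h : x.1 ∈ S <;> simp [claimTerm, h]

lemma claimMoment_two_nonneg (S : Set ℕ) : 0 ≤ claimMoment ν 2 S :=
  integral_nonneg fun x => mul_nonneg (sq_nonneg _) (Set.indicator_nonneg (by simp) _)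

/-- A vanishing second moment would force $Z I\{D\in S\}=0$ a.s., and then the first moment would
vanish too. -/
lemma claimMoment_two_pos (h2 : Integrable (fun x : ℕ × ℝ => x.2 ^ 2) ν) {S : Set ℕ}
    (hpos : 0 < claimMoment ν 1 S) : 0 < claimMoment ν 2 S := by
  refine lt_of_le_of_ne (claimMoment_two_nonneg S) fun h0 => hpos.ne' ?_
  have hae := (integral_eq_zero_iff_of_nonneg
    (fun x => mul_nonneg (sq_nonneg _) (Set.indicator_nonneg (by simp) _))
    (integrable_claimTerm h2 S)).1 h0.symm
  refine integral_eq_zero_of_ae ?_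
  filter_upwards [hae] with x hx
  by_cases h : x.1 ∈ S
  · simpa [claimTerm, h] using hx
  · simp [h]

lemma claimMoment_Iic_succ {p : ℕ} (hp : Integrable (fun x : ℕ × ℝ => x.2 ^ p) ν) (t : ℕ) :
    claimMoment ν p (Set.Iic (t + 1)) = claimMoment ν p (Set.Iic t) + claimMoment ν p {t + 1} := by
  have := integral_add (integrable_claimTerm hp (Set.Iic t)) (integrable_claimTerm hp {t + 1})
  rw [claimMoment, claimMoment, claimMoment]
  simp only [claimTerm] at this
  rw [← this]
  exact integral_congr_ae (ae_of_all _ (claimTerm_Iic_succ p t))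

end Moments

/-- A weighted sum of squares around the weighted mean, in terms of residuals. -/
lemma sum_mul_sq_div_sub_eq {κ : Type*} (s : Finset κ) {C E : κ → ℝ} (hC : ∀ i ∈ s, C i ≠ 0)
    (hS : ∑ i ∈ s, C i ≠ 0) (f : ℝ) :
    ∑ i ∈ s, C i * (E i / C i - (∑ j ∈ s, E j) / ∑ j ∈ s, C j) ^ 2 =
      ∑ i ∈ s, (E i - f * C i) ^ 2 / C i - (∑ i ∈ s, (E i - f * C i)) ^ 2 / ∑ i ∈ s, C i := by
  set F := (∑ j ∈ s, E j) / ∑ j ∈ s, C j with hF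
  have hE : ∑ j ∈ s, E j = F * ∑ j ∈ s, C j := by rw [hF]; field_simp
  -- Write `E i / C i - F = (E i - f * C i) / C i + (f - F)`. After summation the last two terms
  -- combine, because `∑ (E i - f * C i) = (F - f) * ∑ C i`.
  have h1 : ∀ i ∈ s, C i * (E i / C i - F) ^ 2 =
      (E i - f * C i) ^ 2 / C i + 2 * (f - F) * (E i - f * C i) + (f - F) ^ 2 * C i := by
    intro i hi
    have := hC i hi
    field_simp
    ring
  rw [Finset.sum_congr rfl h1, Finset.sum_add_distrib, Finset.sum_add_distrib, ← Finset.mul_sum,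
    ← Finset.mul_sum, Finset.sum_sub_distrib, ← Finset.mul_sum, hE]
  field_simp
  ring

/-! ### Consequences of the model for the moments. -/

namespace IsGeneralModel

variable {Ω : Type*} [MeasurableSpace Ω] {P : Measure Ω} {T : ℕ}
  {M : ℝ≥0 → ℕ → Ω → ℕ} {D : ℕ → ℕ → Ω → ℕ} {Z : ℕ → ℕ → Ω → ℝ} {ν : Measure (ℕ × ℝ)}

lemma integrable_snd_pow_one [IsProbabilityMeasure P] (h : IsGeneralModel P T M D Z ν)
    (hT : 1 ≤ T) : Integrable (fun x : ℕ × ℝ => x.2 ^ 1) ν := by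
  have hlaw := h.claims_law 1 (Finset.mem_Icc.2 ⟨le_rfl, hT⟩) 0
  have : IsProbabilityMeasure ν := by
    rw [← hlaw.map_eq]; exact Measure.isProbabilityMeasure_map hlaw.aemeasurable
  have h2 : MemLp (fun x : ℕ × ℝ => x.2) 2 ν :=
    (memLp_two_iff_integrable_sq measurable_snd.aestronglyMeasurable).2 h.sq_integrable
  simpa using h2.integrable (by norm_num)

lemma claimMoment_Iic_zero (h : IsGeneralModel P T M D Z ν) :
    claimMoment ν 1 (Set.Iic 0) = 0 := by
  refine integral_eq_zero_of_ae ?_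
  filter_upwards [h.dev_mem] with x hx
  have : x.1 ≠ 0 := by have := (Finset.mem_Icc.1 hx).1; omega
  simp [this]

lemma claimMoment_Iic_pos [IsProbabilityMeasure P] (h : IsGeneralModel P T M D Z ν) {t : ℕ}
    (ht : 1 ≤ t) (htT : t ≤ T) : 0 < claimMoment ν 1 (Set.Iic t) := by
  induction t, ht using Nat.le_induction with
  | base =>
    rw [claimMoment_Iic_succ (h.integrable_snd_pow_one htT), h.claimMoment_Iic_zero, zero_add]
    exact h.mean_pos _ (Finset.mem_Icc.2 ⟨le_rfl, htT⟩)
  | succ n hn ih =>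
    rw [claimMoment_Iic_succ (h.integrable_snd_pow_one (by omega))]
    exact add_pos (ih (by omega)) (h.mean_pos _ (Finset.mem_Icc.2 ⟨by omega, htT⟩))

lemma devFactor_sub_one_mul [IsProbabilityMeasure P] (h : IsGeneralModel P T M D Z ν) {t : ℕ}
    (ht : 1 ≤ t) (htT : t ≤ T) :
    (devFactor ν t - 1) * claimMoment ν 1 (Set.Iic t) = claimMoment ν 1 {t + 1} := by
  have hm := h.claimMoment_Iic_pos ht htT
  rw [devFactor, claimMoment_Iic_succ (h.integrable_snd_pow_one (by omega))]
  field_simp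
  ring

/-- This expression is the variance of a single residual at $f=f_t$; the denominators of
$\sigma_t^2$ cancel through $(f_t-1)E[Z I\{D\le t\}]=E[Z I\{D=t+1\}]$. -/
lemma sigmaSq_mul [IsProbabilityMeasure P] (h : IsGeneralModel P T M D Z ν) {t : ℕ}
    (ht : 1 ≤ t) (htT : t + 1 ≤ T) :
    sigmaSq ν t * claimMoment ν 1 (Set.Iic t) =
      claimMoment ν 2 {t + 1} + (devFactor ν t - 1) ^ 2 * claimMoment ν 2 (Set.Iic t) := by
  have hm := h.claimMoment_Iic_pos ht (by omega)
  have hs := h.mean_pos (t + 1) (Finset.mem_Icc.2 ⟨by omega, htT⟩)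
  have hf := h.devFactor_sub_one_mul ht (by omega)
  rw [sigmaSq, ← hf]
  rw [← hf] at hs
  have hf0 : devFactor ν t - 1 ≠ 0 := fun h0 => by simp [h0] at hs
  field_simp

lemma sigmaSq_pos [IsProbabilityMeasure P] (h : IsGeneralModel P T M D Z ν) {t : ℕ}
    (ht : 1 ≤ t) (htT : t + 1 ≤ T) : 0 < sigmaSq ν t := by
  have hm := h.claimMoment_Iic_pos ht (by omega)
  have hs := h.mean_pos (t + 1) (Finset.mem_Icc.2 ⟨by omega, htT⟩)
  refine pos_of_mul_pos_left (b := claimMoment ν 1 (Set.Iic t)) ?_ hm.le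
  rw [h.sigmaSq_mul ht htT]
  exact add_pos_of_pos_of_nonneg (claimMoment_two_pos h.sq_integrable hs)
    (mul_nonneg (sq_nonneg _) (claimMoment_two_nonneg _))

/-- The development factor is precisely the value that centres the residual, as the central limit
theorem requires. -/
lemma integral_claimResidual [IsProbabilityMeasure P] (h : IsGeneralModel P T M D Z ν) {t : ℕ}
    (ht : 1 ≤ t) (htT : t ≤ T) : ∫ x, claimResidual (devFactor ν t) t x ∂ν = 0 := by
  have h1 := h.integrable_snd_pow_one (by omega)
  have hf := h.devFactor_sub_one_mul ht htT
  have hadd := claimMoment_Iic_succ h1 t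
  simp only [claimResidual]
  rw [integral_sub (integrable_claimTerm h1 _) ((integrable_claimTerm h1 _).const_mul _),
    integral_const_mul]
  change claimMoment ν 1 (Set.Iic (t + 1)) - devFactor ν t * claimMoment ν 1 (Set.Iic t) = 0
  linarith

lemma integral_claimResidual_sq [IsProbabilityMeasure P] (h : IsGeneralModel P T M D Z ν) {t : ℕ}
    (ht : 1 ≤ t) (htT : t + 1 ≤ T) :
    ∫ x, claimResidual (devFactor ν t) t x ^ 2 ∂ν
      = sigmaSq ν t * claimMoment ν 1 (Set.Iic t) := by
  simp only [claimResidual_sq]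
  rw [integral_add (integrable_claimTerm h.sq_integrable _)
    ((integrable_claimTerm h.sq_integrable _).const_mul _), integral_const_mul,
    h.sigmaSq_mul ht htT]
  rfl

end IsGeneralModel

/-! ### Accumulated claims as random sums, measurability, and the law of large numbers. -/

section Sums

variable {Ω : Type*} {M : ℝ≥0 → ℕ → Ω → ℕ} {D : ℕ → ℕ → Ω → ℕ} {Z : ℕ → ℕ → Ω → ℝ}

lemma cumClaims_eq_sum_claimTerm (α : ℝ≥0) (i t : ℕ) (ω : Ω) :
    cumClaims M D Z α i t ω
      = ∑ k ∈ Finset.range (M α i ω), claimTerm 1 (Set.Iic t) (D i k ω, Z i k ω) := by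
  refine Finset.sum_congr rfl fun k _ => ?_
  by_cases h : D i k ω ≤ t <;> simp [claimTerm, h]

lemma cumClaims_succ_sub (f : ℝ) (α : ℝ≥0) (i t : ℕ) (ω : Ω) :
    cumClaims M D Z α i (t + 1) ω - f * cumClaims M D Z α i t ω
      = ∑ k ∈ Finset.range (M α i ω), claimResidual f t (D i k ω, Z i k ω) := by
  simp only [cumClaims_eq_sum_claimTerm, claimResidual, Finset.sum_sub_distrib, Finset.mul_sum]

end Sums

namespace IsGeneralModel

variable {Ω : Type*} [MeasurableSpace Ω] {P : Measure Ω} {T : ℕ}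
  {M : ℝ≥0 → ℕ → Ω → ℕ} {D : ℕ → ℕ → Ω → ℕ} {Z : ℕ → ℕ → Ω → ℝ} {ν : Measure (ℕ × ℝ)}

lemma measurable_cumClaims (h : IsGeneralModel P T M D Z ν) (α : ℝ≥0) {i : ℕ}
    (hi : i ∈ Finset.Icc 1 T) (t : ℕ) : Measurable (cumClaims M D Z α i t) := by
  have hn : ∀ n, Measurable fun ω =>
      ∑ k ∈ Finset.range n, if D i k ω ≤ t then Z i k ω else 0 := fun n =>
    Finset.measurable_sum _ fun k _ => Measurable.ite
      (measurableSet_le (h.measurable_D i hi k) measurable_const) (h.measurable_Z i hi k)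
      measurable_const
  exact (measurable_from_prod_countable_left
    (f := fun p : Ω × ℕ => ∑ k ∈ Finset.range p.2, if D i k p.1 ≤ t then Z i k p.1 else 0) hn).comp
    (measurable_id.prodMk (h.measurable_M α i hi))

lemma measurable_fHat (h : IsGeneralModel P T M D Z ν) (α : ℝ≥0) (t : ℕ) :
    Measurable (fHat T M D Z α t) := by
  have hs : ∀ s, Measurable fun ω => ∑ i ∈ Finset.Icc 1 (T - t), cumClaims M D Z α i s ω :=
    fun s => Finset.measurable_sum _ fun i hi => h.measurable_cumClaims α
      (Finset.Icc_subset_Icc_right (Nat.sub_le _ _) hi) s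
  exact (hs _).div (hs _)

lemma measurable_sigmaSqHat (h : IsGeneralModel P T M D Z ν) (α : ℝ≥0) (t : ℕ) :
    Measurable (sigmaSqHat T M D Z α t) := by
  refine (Finset.measurable_sum _ fun i hi => ?_).const_mul _
  have hc := h.measurable_cumClaims α (Finset.Icc_subset_Icc_right (Nat.sub_le _ _) hi)
  exact (hc _).mul ((((hc _).div (hc _)).sub (h.measurable_fHat α t)).pow_const 2)

lemma tendsto_count (h : IsGeneralModel P T M D Z ν) {i : ℕ} (hi : i ∈ Finset.Icc 1 T) :
    ∀ᵐ ω ∂P, Tendsto (fun α => M α i ω) atTop atTop := by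
  obtain ⟨l, hl, hlim⟩ := h.exposure i hi
  filter_upwards [hlim] with ω hω
  have hα : Tendsto (fun α : ℝ≥0 => (α : ℝ)) atTop atTop := NNReal.tendsto_coe_atTop.2 tendsto_id
  refine tendsto_natCast_atTop_iff (R := ℝ) |>.1 ?_
  refine (hω.pos_mul_atTop hl hα).congr' ?_
  filter_upwards [eventually_gt_atTop 0] with α hα0
  have : (α : ℝ) ≠ 0 := by exact_mod_cast hα0.ne'
  field_simp

lemma iIndepFun_claims (h : IsGeneralModel P T M D Z ν) {i : ℕ} (hi : i ∈ Finset.Icc 1 T)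
    {g : ℕ × ℝ → ℝ} (hg : Measurable g) : iIndepFun (fun k ω => g (D i k ω, Z i k ω)) P :=
  (h.claims_indep i hi).comp (fun _ => g) fun _ => hg

lemma measurable_claims (h : IsGeneralModel P T M D Z ν) {i : ℕ} (hi : i ∈ Finset.Icc 1 T)
    (k : ℕ) : Measurable fun ω => (D i k ω, Z i k ω) :=
  (h.measurable_D i hi k).prodMk (h.measurable_Z i hi k)

lemma identDistrib_claims (h : IsGeneralModel P T M D Z ν) {i : ℕ} (hi : i ∈ Finset.Icc 1 T)
    {g : ℕ × ℝ → ℝ} (hg : Measurable g) (k : ℕ) :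
    IdentDistrib (fun ω => g (D i k ω, Z i k ω)) (fun ω => g (D i 0 ω, Z i 0 ω)) P P :=
  IdentDistrib.comp (u := g)
    ⟨(h.measurable_claims hi k).aemeasurable, (h.measurable_claims hi 0).aemeasurable,
      by rw [(h.claims_law i hi k).map_eq, (h.claims_law i hi 0).map_eq]⟩ hg

lemma integral_claims (h : IsGeneralModel P T M D Z ν) {i : ℕ} (hi : i ∈ Finset.Icc 1 T)
    {g : ℕ × ℝ → ℝ} (hg : Measurable g) (k : ℕ) :
    ∫ ω, g (D i k ω, Z i k ω) ∂P = ∫ x, g x ∂ν := by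
  rw [← (h.claims_law i hi k).map_eq,
    integral_map (h.measurable_claims hi k).aemeasurable hg.aestronglyMeasurable]

/-- The law of large numbers for the accumulated claims, relative to the exposure. -/
lemma tendsto_cumClaims_div [IsProbabilityMeasure P] (h : IsGeneralModel P T M D Z ν) {i : ℕ}
    (hi : i ∈ Finset.Icc 1 T) {l : ℝ}
    (hl : ∀ᵐ ω ∂P, Tendsto (fun α : ℝ≥0 => (M α i ω : ℝ) / (α : ℝ)) atTop (𝓝 l)) (t : ℕ) :
    ∀ᵐ ω ∂P, Tendsto (fun α : ℝ≥0 => cumClaims M D Z α i t ω / (α : ℝ)) atTop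
      (𝓝 (l * claimMoment ν 1 (Set.Iic t))) := by
  have hg := measurable_claimTerm 1 (Set.Iic t)
  have hT : 1 ≤ T := (Finset.mem_Icc.1 hi).1.trans (Finset.mem_Icc.1 hi).2
  have hint : Integrable (fun ω => claimTerm 1 (Set.Iic t) (D i 0 ω, Z i 0 ω)) P := by
    have := integrable_claimTerm (h.integrable_snd_pow_one hT) (Set.Iic t)
    rw [← (h.claims_law i hi 0).map_eq] at this
    exact this.comp_measurable (h.measurable_claims hi 0)
  have hslln := strong_law_ae_real (fun k ω => claimTerm 1 (Set.Iic t) (D i k ω, Z i k ω)) hint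
    (fun a b hab => (h.iIndepFun_claims hi hg).indepFun hab) (h.identDistrib_claims hi hg)
  rw [h.integral_claims hi hg 0] at hslln
  filter_upwards [hslln, hl, h.tendsto_count hi] with ω h1 h2 h3
  -- Pathwise, $C/\alpha=(M/\alpha)\cdot(C/M)$ once $M>0$, and $C/M$ is the strong law's average at
  -- index $M$.
  refine (h2.mul (h1.comp h3)).congr' ?_
  filter_upwards [h3.eventually_gt_atTop 0] with α hM
  have : (M α i ω : ℝ) ≠ 0 := by positivity
  simp only [Function.comp_apply, cumClaims_eq_sum_claimTerm]
  field_simp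

/-- The exposure rates of all accident years. -/
lemma exists_exposure_rates (h : IsGeneralModel P T M D Z ν) :
    ∃ l : ℕ → ℝ, (∀ i ∈ Finset.Icc 1 T, 0 < l i) ∧
      ∀ᵐ ω ∂P, ∀ i ∈ Finset.Icc 1 T,
        Tendsto (fun α : ℝ≥0 => (M α i ω : ℝ) / (α : ℝ)) atTop (𝓝 (l i)) := by
  choose! l hl using h.exposure
  exact ⟨l, fun i hi => (hl i hi).1,
    (ae_ball_iff (Finset.countable_toSet _)).2 fun i hi => (hl i hi).2⟩

lemma ae_tendsto_cumClaims_div [IsProbabilityMeasure P] (h : IsGeneralModel P T M D Z ν)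
    {l : ℕ → ℝ} (hl : ∀ᵐ ω ∂P, ∀ i ∈ Finset.Icc 1 T,
      Tendsto (fun α : ℝ≥0 => (M α i ω : ℝ) / (α : ℝ)) atTop (𝓝 (l i))) :
    ∀ᵐ ω ∂P, ∀ t, ∀ i ∈ Finset.Icc 1 T,
      Tendsto (fun α : ℝ≥0 => cumClaims M D Z α i t ω / (α : ℝ)) atTop
        (𝓝 (l i * claimMoment ν 1 (Set.Iic t))) :=
  ae_all_iff.2 fun t => (ae_ball_iff (Finset.countable_toSet _)).2 fun i hi =>
    h.tendsto_cumClaims_div hi (hl.mono fun _ hω => hω i hi) t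

end IsGeneralModel

lemma tendsto_div_of_tendsto_div_coe {a b : ℝ≥0 → ℝ} {x y : ℝ}
    (ha : Tendsto (fun α => a α / (α : ℝ)) atTop (𝓝 x))
    (hb : Tendsto (fun α => b α / (α : ℝ)) atTop (𝓝 y)) (hy : y ≠ 0) :
    Tendsto (fun α => a α / b α) atTop (𝓝 (x / y)) := by
  refine (ha.div hb hy).congr' ?_
  filter_upwards [eventually_gt_atTop 0] with α hα
  exact div_div_div_cancel_right₀ (by exact_mod_cast hα.ne') _ _

lemma eventually_pos_of_tendsto_div_coe {a : ℝ≥0 → ℝ} {x : ℝ}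
    (ha : Tendsto (fun α => a α / (α : ℝ)) atTop (𝓝 x)) (hx : 0 < x) :
    ∀ᶠ α in atTop, 0 < a α := by
  filter_upwards [ha.eventually_const_lt hx] with α hα
  exact (div_pos_iff.1 hα).elim (·.1) fun h => absurd α.2 (not_le.2 h.2)

/-! ### Strong consistency of development factors and predictors. -/

namespace IsGeneralModel

variable {Ω : Type*} [MeasurableSpace Ω] {P : Measure Ω} {T : ℕ}
  {M : ℝ≥0 → ℕ → Ω → ℕ} {D : ℕ → ℕ → Ω → ℕ} {Z : ℕ → ℕ → Ω → ℝ} {ν : Measure (ℕ × ℝ)}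

/-- Strong consistency of the development factor estimators. -/
theorem ae_tendsto_fHat [IsProbabilityMeasure P] (h : IsGeneralModel P T M D Z ν) {t : ℕ}
    (ht : 1 ≤ t) (htT : t + 1 ≤ T) :
    ∀ᵐ ω ∂P, Tendsto (fun α => fHat T M D Z α t ω) atTop (𝓝 (devFactor ν t)) := by
  obtain ⟨l, hl, hlim⟩ := h.exists_exposure_rates
  have hsub : Finset.Icc 1 (T - t) ⊆ Finset.Icc 1 T := Finset.Icc_subset_Icc_right (Nat.sub_le _ _)
  have hL : 0 < ∑ i ∈ Finset.Icc 1 (T - t), l i :=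
    Finset.sum_pos (fun i hi => hl i (hsub hi)) ⟨1, Finset.mem_Icc.2 ⟨le_rfl, by omega⟩⟩
  have hm := h.claimMoment_Iic_pos ht (by omega)
  filter_upwards [h.ae_tendsto_cumClaims_div hlim] with ω hω
  have hsum : ∀ s, Tendsto
      (fun α : ℝ≥0 => (∑ i ∈ Finset.Icc 1 (T - t), cumClaims M D Z α i s ω) / (α : ℝ)) atTop
      (𝓝 ((∑ i ∈ Finset.Icc 1 (T - t), l i) * claimMoment ν 1 (Set.Iic s))) := fun s => by
    simp only [Finset.sum_div, Finset.sum_mul]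
    exact tendsto_finsetSum _ fun i hi => hω s i (hsub hi)
  have := tendsto_div_of_tendsto_div_coe (hsum (t + 1)) (hsum t) (by positivity)
  rwa [mul_div_mul_left _ _ hL.ne'] at this

/-- The product telescopes, since each factor is a quotient of consecutive, positive moments. -/
lemma claimMoment_mul_prod_devFactor [IsProbabilityMeasure P] (h : IsGeneralModel P T M D Z ν)
    {s n : ℕ} (hs : 1 ≤ s) (hsn : s ≤ n) (hn : n ≤ T) :
    claimMoment ν 1 (Set.Iic s) * ∏ t ∈ Finset.Ico s n, devFactor ν t
      = claimMoment ν 1 (Set.Iic n) := by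
  induction n, hsn using Nat.le_induction with
  | base => simp
  | succ n hsn ih =>
    have hm := h.claimMoment_Iic_pos (t := n) (by omega) (by omega)
    rw [Finset.prod_Ico_succ_top hsn, ← mul_assoc, ih (by omega), devFactor]
    field_simp

/-- Strong consistency of the chain-ladder predictors. -/
theorem ae_tendsto_predictor_div [IsProbabilityMeasure P] (h : IsGeneralModel P T M D Z ν) {i : ℕ}
    (hi : 2 ≤ i) (hiT : i ≤ T) :
    ∀ᵐ ω ∂P, Tendsto (fun α => predictor T M D Z α i ω / cumClaims M D Z α i T ω) atTop
      (𝓝 1) := by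
  obtain ⟨l, hl, hlim⟩ := h.exists_exposure_rates
  have hiI : i ∈ Finset.Icc 1 T := Finset.mem_Icc.2 ⟨by omega, hiT⟩
  have hf : ∀ᵐ ω ∂P, ∀ t ∈ Finset.Icc (T - i + 1) (T - 1),
      Tendsto (fun α => fHat T M D Z α t ω) atTop (𝓝 (devFactor ν t)) :=
    (ae_ball_iff (Finset.countable_toSet _)).2 fun t ht => by
      have ht := Finset.mem_Icc.1 ht
      exact h.ae_tendsto_fHat (by omega) (by omega)
  have hm := h.claimMoment_Iic_pos (t := T) (by omega) le_rfl
  have hli := hl i hiI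
  filter_upwards [h.ae_tendsto_cumClaims_div hlim, hf] with ω hω hfω
  have hprod := tendsto_finsetProd (Finset.Icc (T - i + 1) (T - 1)) hfω
  have hnum := (hω (T - i + 1) i hiI).mul hprod
  have hIcc : Finset.Icc (T - i + 1) (T - 1) = Finset.Ico (T - i + 1) T := by
    ext t; simp only [Finset.mem_Icc, Finset.mem_Ico]; omega
  have hval : l i * claimMoment ν 1 (Set.Iic (T - i + 1)) *
      ∏ t ∈ Finset.Icc (T - i + 1) (T - 1), devFactor ν t = l i * claimMoment ν 1 (Set.Iic T) := by
    rw [hIcc, mul_assoc, h.claimMoment_mul_prod_devFactor (by omega) (by omega) le_rfl]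
  rw [hval] at hnum
  have := tendsto_div_of_tendsto_div_coe (a := fun α => predictor T M D Z α i ω)
    (hnum.congr fun α => by rw [predictor, div_mul_eq_mul_div]) (hω T i hiI) (by positivity)
  rwa [div_self (by positivity)] at this

end IsGeneralModel

/-! ### Central limit theorem with random numbers of claims. -/

/-- The normalized sum `(√n)⁻¹ * ∑ k < n, g (x k)`. -/
noncomputable def normalizedSum (g : ℕ × ℝ → ℝ) (n : ℕ) (x : ℕ → ℕ × ℝ) : ℝ :=
  (√n)⁻¹ * ∑ k ∈ Finset.range n, g (x k)

lemma measurable_normalizedSum {g : ℕ × ℝ → ℝ} (hg : Measurable g) (n : ℕ) :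
    Measurable (normalizedSum g n) :=
  (Finset.measurable_sum _ fun k _ => hg.comp (measurable_pi_apply k)).const_mul _

lemma measurable_uncurry_normalizedSum {g : ℕ × ℝ → ℝ} (hg : Measurable g) :
    Measurable fun p : ℕ × (ℕ → ℕ × ℝ) => normalizedSum g p.1 p.2 :=
  measurable_from_prod_countable_right fun n => measurable_normalizedSum hg n

namespace IsGeneralModel

variable {Ω : Type*} [MeasurableSpace Ω] {P : Measure Ω} {T : ℕ}
  {M : ℝ≥0 → ℕ → Ω → ℕ} {D : ℕ → ℕ → Ω → ℕ} {Z : ℕ → ℕ → Ω → ℝ} {ν : Measure (ℕ × ℝ)}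

/-- The central limit theorem for the claims of one accident year, with a random number of
summands. -/
lemma tendstoInDistribution_normalizedSum [IsProbabilityMeasure P]
    (h : IsGeneralModel P T M D Z ν) {i : ℕ} (hi : i ∈ Finset.Icc 1 T) {g : ℕ × ℝ → ℝ}
    (hg : Measurable g) (h0 : ∫ x, g x ∂ν = 0) (h1 : ∫ x, g x ^ 2 ∂ν = 1) :
    TendstoInDistribution
      (fun (α : ℝ≥0) ω => normalizedSum g (M α i ω) fun k => (D i k ω, Z i k ω)) atTop id
      (fun _ => P) (gaussianReal 0 1) := by
  have hpi : Measurable fun ω (k : ℕ) => (D i k ω, Z i k ω) :=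
    measurable_pi_lambda _ (h.measurable_claims hi)
  have hclt := tendstoInDistribution_inv_sqrt_mul_sum (P := P)
    (X := fun k ω => g (D i k ω, Z i k ω)) (Y := id) (P' := gaussianReal 0 1) HasLaw.id
    (by rw [h.integral_claims hi hg 0, h0])
    (by
      have := h.integral_claims hi (hg.pow_const 2) 0
      rw [h1] at this
      exact this)
    (h.iIndepFun_claims hi hg) (h.identDistrib_claims hi hg)
  exact tendstoInDistribution_random_index
    (S := fun n ω => normalizedSum g n fun k => (D i k ω, Z i k ω))
    (fun n => (measurable_normalizedSum hg n).comp hpi) (fun α => h.measurable_M α i hi)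
    (fun α => (h.claims_indep_count α i hi).comp
      (φ := fun x n => normalizedSum g n x) (ψ := id)
      (measurable_pi_lambda _ (measurable_normalizedSum hg)) measurable_id)
    (h.tendsto_count hi) hclt

/-- The joint central limit theorem for the accident years `1, …, n`. -/
lemma tendstoInDistribution_normalizedSum_pi [IsProbabilityMeasure P]
    (h : IsGeneralModel P T M D Z ν) {n : ℕ} (hn : n ≤ T) {g : ℕ × ℝ → ℝ}
    (hg : Measurable g) (h0 : ∫ x, g x ∂ν = 0) (h1 : ∫ x, g x ^ 2 ∂ν = 1) :
    TendstoInDistribution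
      (fun (α : ℝ≥0) ω (i : Finset.Icc 1 n) =>
        normalizedSum g (M α i ω) fun k => (D i k ω, Z i k ω)) atTop id
      (fun _ => P) (Measure.pi fun _ : Finset.Icc 1 n => gaussianReal 0 1) := by
  have hsub : Finset.Icc 1 n ⊆ Finset.Icc 1 T := Finset.Icc_subset_Icc_right hn
  refine tendstoInDistribution_pi_of_iIndepFun
    (X := fun α (i : Finset.Icc 1 n) ω =>
      normalizedSum g (M α i ω) fun k => (D i k ω, Z i k ω)) (fun α => ?_)
    fun i => h.tendstoInDistribution_normalizedSum (hsub i.2) hg h0 h1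
  have hinj : Function.Injective fun i : Finset.Icc 1 n => (⟨i, hsub i.2⟩ : Finset.Icc 1 T) :=
    fun a b hab => Subtype.ext (congrArg (fun x : Finset.Icc 1 T => (x : ℕ)) hab)
  exact ((h.years_indep α).precomp hinj).comp
    (fun _ (p : ℕ × (ℕ → ℕ × ℝ)) => normalizedSum g p.1 p.2)
    fun _ => measurable_uncurry_normalizedSum hg

end IsGeneralModel

/-! ### Mack's variance estimator as a quadratic form, and its limit law. -/

/-- A quadratic form whose value at normalized sums of residuals and suitable coefficients is
Mack's variance estimator. -/
noncomputable def residualForm {κ : Type*} [Fintype κ] (r : ℝ) (p : (κ → ℝ) × (κ → ℝ × ℝ)) : ℝ :=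
  r * (∑ i, p.1 i ^ 2 * (p.2 i).1 - (∑ i, p.1 i * (p.2 i).2) ^ 2)

lemma continuous_residualForm {κ : Type*} [Fintype κ] (r : ℝ) :
    Continuous (residualForm (κ := κ) r) := by
  unfold residualForm
  fun_prop

/-- Mack's variance estimator is a quadratic form in the normalized sums of residuals. -/
lemma sigmaSqHat_eq_residualForm {Ω : Type*} {T : ℕ} {M : ℝ≥0 → ℕ → Ω → ℕ}
    {D : ℕ → ℕ → Ω → ℕ} {Z : ℕ → ℕ → Ω → ℝ} {α : ℝ≥0} {t : ℕ} {ω : Ω} {v : ℝ} (hv : 0 < v)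
    (f : ℝ) (hC : ∀ i ∈ Finset.Icc 1 (T - t), 0 < cumClaims M D Z α i t ω)
    (hS : 0 < ∑ i ∈ Finset.Icc 1 (T - t), cumClaims M D Z α i t ω) :
    sigmaSqHat T M D Z α t ω = residualForm (κ := Finset.Icc 1 (T - t)) (1 / ((T - t - 1 : ℕ) : ℝ))
      (fun i => normalizedSum (fun x => claimResidual f t x / √v) (M α i ω)
          fun k => (D i k ω, Z i k ω),
        fun i => (v * M α i ω / cumClaims M D Z α i t ω,
          √(v * M α i ω / ∑ j ∈ Finset.Icc 1 (T - t), cumClaims M D Z α j t ω))) := by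
  have hR : ∀ i ∈ Finset.Icc 1 (T - t),
      normalizedSum (fun x => claimResidual f t x / √v) (M α i ω) (fun k => (D i k ω, Z i k ω))
        = (cumClaims M D Z α i (t + 1) ω - f * cumClaims M D Z α i t ω) / √(v * M α i ω) := by
    intro i _
    rw [normalizedSum, cumClaims_succ_sub, ← Finset.sum_div, Real.sqrt_mul hv.le]
    ring
  have hM : ∀ i ∈ Finset.Icc 1 (T - t), 0 < v * M α i ω := by
    intro i hi
    -- An empty sum is zero, so positive accumulated claims exclude `M = 0`.
    have : M α i ω ≠ 0 := fun h0 => by simpa [cumClaims, h0] using hC i hi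
    positivity
  rw [sigmaSqHat, residualForm]
  congr 1
  simp only [fHat]
  -- The identity holds for every centring `f`; the true development factor is substituted only when
  -- the limit is taken.
  rw [sum_mul_sq_div_sub_eq _ (fun i hi => (hC i hi).ne') hS.ne' f]
  congr 1
  · rw [← Finset.sum_coe_sort]
    refine Finset.sum_congr rfl fun i _ => ?_
    have h2 := hM i i.2
    rw [hR i i.2, div_pow, Real.sq_sqrt h2.le, div_mul_div_cancel₀ h2.ne']
  · have hterm : ∀ i : Finset.Icc 1 (T - t),
        normalizedSum (fun x => claimResidual f t x / √v) (M α i ω) (fun k => (D i k ω, Z i k ω)) *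
          √(v * M α i ω / ∑ j ∈ Finset.Icc 1 (T - t), cumClaims M D Z α j t ω)
        = (cumClaims M D Z α i (t + 1) ω - f * cumClaims M D Z α i t ω) /
          √(∑ j ∈ Finset.Icc 1 (T - t), cumClaims M D Z α j t ω) := by
      intro i
      have h2 := Real.sqrt_pos.2 (hM i i.2)
      rw [hR i i.2, Real.sqrt_div (hM i i.2).le]
      field_simp
    simp only [hterm]
    rw [← Finset.sum_div, div_pow, Real.sq_sqrt hS.le]
    congr 2
    exact (Finset.sum_coe_sort _
      fun i => cumClaims M D Z α i (t + 1) ω - f * cumClaims M D Z α i t ω).symm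

/-- The law of the limiting quadratic form. -/
lemma map_residualForm_pi_gaussianReal {κ : Type*} [Fintype κ] {m : ℕ}
    (hcard : Fintype.card κ = m + 1) {s : ℝ} (hs : 0 < s) {l : κ → ℝ} (hl : ∀ i, 0 < l i) :
    (Measure.pi fun _ : κ => gaussianReal 0 1).map
      (fun x => residualForm (1 / (m : ℝ)) (x, fun i => (s, √(s * (l i / ∑ j, l j)))))
      = (chiSqLaw m).map fun x : ℝ => s * (x / m) := by
  have : Nonempty κ := Fintype.card_pos_iff.1 (by omega)
  have hL : 0 < ∑ j, l j := Finset.sum_pos (fun i _ => hl i) Finset.univ_nonempty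
  -- The normalized exposure rates supply the unit vector for Cochran's theorem.
  have hu : ∑ i, √(l i / ∑ j, l j) ^ 2 = 1 := by
    simp only [fun i => Real.sq_sqrt (div_pos (hl i) hL).le]
    rw [← Finset.sum_div, div_self hL.ne']
  rw [← map_sum_sq_sub_sq_pi_gaussianReal hcard hu, Measure.map_map (by fun_prop) (by fun_prop)]
  congr 1
  funext x
  have h1 : ∑ i, x i * √(s * (l i / ∑ j, l j)) = √s * ∑ i, √(l i / ∑ j, l j) * x i := by
    rw [Finset.mul_sum]
    refine Finset.sum_congr rfl fun i _ => ?_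
    rw [Real.sqrt_mul hs.le]
    ring
  simp only [Function.comp_apply, residualForm]
  rw [h1, mul_pow, Real.sq_sqrt hs.le, ← Finset.sum_mul]
  ring

namespace IsGeneralModel

variable {Ω : Type*} [MeasurableSpace Ω] {P : Measure Ω} {T : ℕ}
  {M : ℝ≥0 → ℕ → Ω → ℕ} {D : ℕ → ℕ → Ω → ℕ} {Z : ℕ → ℕ → Ω → ℝ} {ν : Measure (ℕ × ℝ)}

/-- Convergence in distribution of Mack's variance estimator. -/
theorem tendstoInDistribution_sigmaSqHat [IsProbabilityMeasure P] (h : IsGeneralModel P T M D Z ν)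
    {t : ℕ} (ht : 1 ≤ t) (htT : t + 2 ≤ T) :
    TendstoInDistribution (fun α => sigmaSqHat T M D Z α t) atTop
      (fun x : ℝ => sigmaSq ν t * (x / ((T - t - 1 : ℕ) : ℝ)))
      (fun _ => P) (chiSqLaw (T - t - 1)) := by
  obtain ⟨l, hl, hlim⟩ := h.exists_exposure_rates
  set n := T - t with hn
  have hsub : Finset.Icc 1 n ⊆ Finset.Icc 1 T := Finset.Icc_subset_Icc_right (Nat.sub_le _ _)
  have hL : 0 < ∑ i ∈ Finset.Icc 1 n, l i :=
    Finset.sum_pos (fun i hi => hl i (hsub hi)) ⟨1, Finset.mem_Icc.2 ⟨le_rfl, by omega⟩⟩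
  have hm := h.claimMoment_Iic_pos ht (by omega)
  have hs := h.sigmaSq_pos ht (by omega)
  set f := devFactor ν t
  set m := claimMoment ν 1 (Set.Iic t)
  -- The variance of one residual, so that `g` below is centred with unit variance.
  set v := sigmaSq ν t * m with hvdef
  have hv : 0 < v := mul_pos hs hm
  set g : ℕ × ℝ → ℝ := fun x => claimResidual f t x / √v
  have hg : Measurable g := (measurable_claimResidual f t).div_const _
  have hg0 : ∫ x, g x ∂ν = 0 := by
    rw [integral_div, h.integral_claimResidual ht (by omega), zero_div]
  have hg1 : ∫ x, g x ^ 2 ∂ν = 1 := by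
    simp only [g, div_pow, Real.sq_sqrt hv.le]
    rw [integral_div, h.integral_claimResidual_sq ht (by omega), div_self hv.ne']
  set W : ℝ≥0 → Ω → Finset.Icc 1 n → ℝ := fun α ω i =>
    normalizedSum g (M α i ω) fun k => (D i k ω, Z i k ω)
  have hW := h.tendstoInDistribution_normalizedSum_pi (n := n) (Nat.sub_le _ _) hg hg0 hg1
  set A : ℝ≥0 → Ω → Finset.Icc 1 n → ℝ × ℝ := fun α ω i =>
    (v * M α i ω / cumClaims M D Z α i t ω,
      √(v * M α i ω / ∑ j ∈ Finset.Icc 1 n, cumClaims M D Z α j t ω))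
  -- With $C_{i,t}\sim\alpha\lambda_i m$ and $M_i\sim\alpha\lambda_i$, the value $v=\sigma_t^2m$
  -- gives $vM_i/C_{i,t}\to\sigma_t^2$ and
  -- $vM_i/\sum_jC_{j,t}\to\sigma_t^2\lambda_i/\sum_j\lambda_j$.
  set c : Finset.Icc 1 n → ℝ × ℝ := fun i =>
    (sigmaSq ν t, √(sigmaSq ν t * (l i / ∑ j : Finset.Icc 1 n, l j)))
  have hAmeas : ∀ α, Measurable (A α) := fun α => measurable_pi_lambda _ fun i => by
    have h1 : Measurable fun ω => v * (M α i ω : ℝ) :=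
      (measurable_from_top.comp (h.measurable_M α i (hsub i.2))).const_mul v
    exact (h1.div (h.measurable_cumClaims α (hsub i.2) t)).prodMk
      (h1.div (Finset.measurable_sum _ fun j hj =>
        h.measurable_cumClaims α (hsub hj) t)).sqrt
  have hA : ∀ᵐ ω ∂P, Tendsto (fun α => A α ω) atTop (𝓝 c) := by
    filter_upwards [h.ae_tendsto_cumClaims_div hlim, hlim] with ω hω hMω
    refine tendsto_pi_nhds.2 fun i => ?_
    have hli := hl i (hsub i.2)
    have hnum : Tendsto (fun α : ℝ≥0 => v * (M α i ω : ℝ) / (α : ℝ)) atTop (𝓝 (v * l i)) := by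
      simp only [mul_div_assoc]
      exact (hMω i (hsub i.2)).const_mul v
    have hsum : Tendsto
        (fun α : ℝ≥0 => (∑ i ∈ Finset.Icc 1 n, cumClaims M D Z α i t ω) / (α : ℝ)) atTop
        (𝓝 ((∑ i ∈ Finset.Icc 1 n, l i) * m)) := by
      simp only [Finset.sum_div, Finset.sum_mul]
      exact tendsto_finsetSum _ fun i hi => hω t i (hsub hi)
    refine Tendsto.prodMk_nhds ?_ (Tendsto.sqrt ?_)
    · convert tendsto_div_of_tendsto_div_coe hnum (hω t i (hsub i.2)) (by positivity) using 2
      change _ = v * l i / (l i * m)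
      rw [hvdef]
      field_simp
    · convert tendsto_div_of_tendsto_div_coe hnum hsum (by positivity) using 2
      rw [hvdef, Finset.sum_coe_sort _ l]
      field_simp
  have hσ := tendstoInDistribution_of_eventually_eq_continuous hW hAmeas hA
    (continuous_residualForm (1 / ((n - 1 : ℕ) : ℝ)))
    (fun α => h.measurable_sigmaSqHat α t) (by
      filter_upwards [h.ae_tendsto_cumClaims_div hlim] with ω hω
      -- Individual claims may be negative, so the denominators are positive only eventually; from
      -- then on the convention for division by zero plays no role.
      have hpos : ∀ᶠ α in atTop, ∀ i ∈ Finset.Icc 1 n, 0 < cumClaims M D Z α i t ω :=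
        (eventually_all_finset _).2 fun i hi => eventually_pos_of_tendsto_div_coe
          (hω t i (hsub hi)) (mul_pos (hl i (hsub hi)) hm)
      filter_upwards [hpos] with α hα
      have hS := Finset.sum_pos hα ⟨1, Finset.mem_Icc.2 ⟨le_rfl, by omega⟩⟩
      exact sigmaSqHat_eq_residualForm hv f hα hS)
  refine tendstoInDistribution_congr_law hσ (by fun_prop) ?_
  exact map_residualForm_pi_gaussianReal (κ := Finset.Icc 1 n) (l := fun i => l i)
    (by simp only [Fintype.card_coe, Nat.card_Icc]; omega) hs fun i => hl i (hsub i.2)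

end IsGeneralModel

end ChainLadder

theorem mainTheorem1 {Ω : Type*} [MeasurableSpace Ω] (P : Measure Ω) [IsProbabilityMeasure P]
    (T : ℕ) (M : ℝ≥0 → ℕ → Ω → ℕ) (D : ℕ → ℕ → Ω → ℕ) (Z : ℕ → ℕ → Ω → ℝ)
    (ν : Measure (ℕ × ℝ)) (hmodel : ChainLadder.IsGeneralModel P T M D Z ν) :
    (∀ t : ℕ, 1 ≤ t → t + 1 ≤ T →
      ∀ᵐ ω ∂P, Tendsto (fun α => ChainLadder.fHat T M D Z α t ω) atTop
        (𝓝 (ChainLadder.devFactor ν t))) ∧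
    (∀ i : ℕ, 2 ≤ i → i ≤ T →
      ∀ᵐ ω ∂P, Tendsto (fun α => ChainLadder.predictor T M D Z α i ω /
        ChainLadder.cumClaims M D Z α i T ω) atTop (𝓝 1)) ∧
    (∀ t : ℕ, 1 ≤ t → t + 2 ≤ T →
      TendstoInDistribution (fun α => ChainLadder.sigmaSqHat T M D Z α t) atTop
        (fun x : ℝ => ChainLadder.sigmaSq ν t * (x / ((T - t - 1 : ℕ) : ℝ)))
        (fun _ => P) (ChainLadder.chiSqLaw (T - t - 1)) ∧
      0 < ChainLadder.sigmaSq ν t ∧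
      ∀ c : ℝ, (ChainLadder.chiSqLaw (T - t - 1)).map
        (fun x : ℝ => ChainLadder.sigmaSq ν t * (x / ((T - t - 1 : ℕ) : ℝ))) ≠
          Measure.dirac c) := by
  refine ⟨fun t ht htT => hmodel.ae_tendsto_fHat ht htT,
    fun i hi hiT => hmodel.ae_tendsto_predictor_div hi hiT, fun t ht htT => ?_⟩
  have hs := hmodel.sigmaSq_pos ht (by omega)
  -- At least one degree of freedom is essential: with none, the chi-squared law is the point mass
  -- at zero.
  have hpos : 0 < T - t - 1 := by omega
  exact ⟨hmodel.tendstoInDistribution_sigmaSqHat ht htT, hs,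
    ChainLadder.map_const_mul_div_chiSqLaw_ne_dirac hpos hs.ne' (Nat.cast_ne_zero.2 hpos.ne')⟩
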